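/- **Setting.** For a set $E$, whose elements are regarded as atoms, let $V_0(E)=E$, $V_{n+1}(E)=V_n(E)\cup\mathcal P(V_n(E))$ and $V_\infty(E)=\bigcup_n V_n(E)$. Let $\mathcal U$ be a free (i.e. non-principal) ultrafilter on a set $\mathfrak L$; "eventually" means "for all $\lambda$ in some member of $\mathcal U$". Let $\mathbb R_{\mathfrak L}=(\mathfrak L\times\mathbb R)\uplus \mathbb R^{\mathfrak L}/\mathcal U$, with the topology generated by all subsets of $\mathfrak L\times\mathbb R$ and all sets $\{(\lambda,\varphi(\lambda)):\lambda\in Q\}\cup\{[\varphi]\}$ with $\varphi:\mathfrak L\to\mathbb R$, $Q\in\mathcal U$; a real number $c$ is identified with the class of the constant function $c$. For $\varphi:\mathfrak L\to\mathbb R$ let $\lim_{\lambda\to\Lambda}(\lambda,\varphi(\lambda))$ be the limit along $\mathcal U$ in this Hausdorff space, and let $\mathbb K\supseteq\mathbb R$ be the set of all these limits. For $n\ge 1$ and $\varphi:\mathfrak L\to V_n(\mathbb R)$ define $\lim_{\lambda\to\Lambda}(\lambda,\varphi(\lambda))\in V_n(\mathbb K)$ recursively: if $\varphi$ is eventually real-valued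 it is the limit in $\mathbb R_{\mathfrak L}$ just defined; otherwise it is the set of all $\lim_{\lambda\to\Lambda}(\lambda,\psi(\lambda))$ with $\psi:\mathfrak L\to V_{n-1}(\mathbb R)$ and $\psi(\lambda)\in\varphi(\lambda)$ eventually. (The value does not depend on the choice of $n$.) For $x\in V_\infty(\mathbb R)$ put $x^*=\lim_{\lambda\to\Lambda}(\lambda,x)\in V_\infty(\mathbb K)$. A formula of the first-order language with equality, $\in$, and a constant symbol for each element of $V_\infty(\mathbb R)$ is *bounded* if all its quantifiers occur in the form $\forall x\,(x\in t\to\cdots)$ or $\exists x\,(x\in t\wedge\cdots)$ with $t$ a constant or a variable other than $x$; $p^*$ is obtained from $p$ by changing each constant $c$ to $c^*$. **Theorem.** (1) Suppose that $\mathcal U$ is countably incomplete, i.e. there are $A_n\in\mathcal U$ $(n\in\mathbb N)$ with $\bigcap_n A_n=\emptyset$. Then $(V_\infty(\mathbb R),V_\infty(\mathbb K),*)$ is a nonstandard universe in Keisler's sense, that is: - $*:V_\infty(\mathbb R)\to V_\infty(\mathbb K)$ is one-to-one; $\mathbb R$ is a proper subset of $\mathbb K$; $r^*=r$ for all $r\in\mathbb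 R$; $\mathbb R^*=\mathbb K$; and $x\in y\iff x^*\in y^*$ for all $x,y\in V_\infty(\mathbb R)$ (superstructure embedding); - a bounded sentence $p$ is true in $V_\infty(\mathbb R)$ if and only if $p^*$ is true in $V_\infty(\mathbb K)$ (Leibniz' Principle). (2) For every bounded formula $p(x_1,\dots,x_k)$ with no other free variables, and all functions $\varphi_i:\mathfrak L\to V_{n_i}(\mathbb R)$ with $\xi_i=\lim_{\lambda\to\Lambda}(\lambda,\varphi_i(\lambda))$, $1\le i\le k$, the following are equivalent: $p^*(\xi_1,\dots,\xi_k)$ is true in $V_\infty(\mathbb K)$; the set $\{\lambda\in\mathfrak L: p(\varphi_1(\lambda),\dots,\varphi_k(\lambda))\text{ is true in }V_\infty(\mathbb R)\}$ belongs to $\mathcal U$; $p([\varphi_1],\dots,[\varphi_k])$ is true in the ultrapower $V_\infty(\mathbb R)^{\mathfrak L}/\mathcal U$. -/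

import Mathlib

open Filter Topology FirstOrder

universe u v

namespace LambdaTheory

noncomputable section

/-! ### The superstructure over a set of atoms -/

/-- `Stage E n` is the `n`-th level `V_n(E)` of the superstructure over `E`, the elements of `E`
being atoms.  Since `V_n(E) ⊆ E ∪ 𝒫(V_n(E))`, the usual recursion
`V_{n+1}(E) = V_n(E) ∪ 𝒫(V_n(E))` reads `V_{n+1}(E) = E ∪ 𝒫(V_n(E))`; an element of `V_{n+1}(E)`
is an atom (`Sum.inl`) or a subset of `V_n(E)` (`Sum.inr`). -/
def Stage (E : Type u) : ℕ → Type u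
  | 0 => E
  | n + 1 => E ⊕ Set (Stage E n)

/-- The atom `e`, as an element of `V_{n+1}(E)`. -/
def Stage.ofAtom {E : Type u} {n : ℕ} (e : E) : Stage E (n + 1) := Sum.inl e

/-- The subset `s` of `V_n(E)`, as an element of `V_{n+1}(E)`. -/
def Stage.ofSet {E : Type u} {n : ℕ} (s : Set (Stage E n)) : Stage E (n + 1) := Sum.inr s

/-- The inclusion `V_n(E) ⊆ V_{n+1}(E)`: an atom goes to itself, and a set goes to the set with
the same elements. -/
def Stage.up {E : Type u} : (n : ℕ) → Stage E n → Stage E (n + 1)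
  | 0, a => Stage.ofAtom a
  | _ + 1, Sum.inl a => Stage.ofAtom a
  | n + 1, Sum.inr s => Stage.ofSet (Stage.up n '' s)

theorem Stage.up_injective {E : Type u} : ∀ n : ℕ, Function.Injective (Stage.up (E := E) n)
  | 0 => fun _ _ h => Sum.inl_injective h
  | n + 1 => by
    have ih := Stage.up_injective (E := E) n
    rintro (a | s) (b | t) h
    · exact congrArg Sum.inl (Sum.inl_injective h)
    · exact absurd h Sum.inl_ne_inr
    · exact absurd h Sum.inr_ne_inl
    · exact congrArg Sum.inr (ih.image_injective (Sum.inr_injective h))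

/-- The inclusion `V_m(E) ⊆ V_n(E)` for `m ≤ n`. -/
def Stage.incl {E : Type u} (m n : ℕ) (h : m ≤ n) : Stage E m ↪ Stage E n :=
  ⟨Nat.leRecOn h (fun {k} => Stage.up k),
    Nat.leRecOn_injective h (fun {k} => Stage.up k) Stage.up_injective⟩

instance {E : Type u} : DirectedSystem (Stage E) (Stage.incl (E := E) · · ·) where
  map_self _ x := Nat.leRecOn_self x
  map_map _ _ _ hij hjk x := (Nat.leRecOn_trans hij hjk x).symm

/-- The superstructure `V_∞(E) = ⋃ₙ V_n(E)`, the union of the levels along their inclusions. -/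
def Superstructure (E : Type u) : Type u :=
  DirectLimit (Stage E) (Stage.incl (E := E))

namespace Superstructure

variable {E : Type u}

/-- An element of `V_n(E)` as an element of `V_∞(E)`. -/
def mk (n : ℕ) (x : Stage E n) : Superstructure E :=
  (Quotient.mk _ (⟨n, x⟩ : Σ n, Stage E n) : DirectLimit (Stage E) (Stage.incl (E := E)))

/-- An element of `E` as an element of `V_∞(E)`. -/
def atom (e : E) : Superstructure E := mk 0 e

/-- The set `E` as an element of `V_∞(E)`. -/
def base (E : Type u) : Superstructure E := mk 1 (Stage.ofSet (Set.univ : Set (Stage E 0)))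

/-- The membership relation of `V_∞(E)`: `x ∈ y` if for some `n`, `y` is (given by) a subset `s`
of `V_n(E)` and `x` is (given by) an element of `s`. -/
def Mem (x y : Superstructure E) : Prop :=
  ∃ (n : ℕ) (a : Stage E n) (s : Set (Stage E n)),
    a ∈ s ∧ x = mk n a ∧ y = mk (n + 1) (Stage.ofSet s)

end Superstructure

/-! ### Bounded formulas of the language of set theory -/

/-- The relation symbols of the language of set theory: one binary symbol `∈`. -/
inductive MemSymbol : ℕ → Type
  | mem : MemSymbol 2

/-- The language of set theory (equality is built into first-order logic).  The language with a
constant symbol for each element of `C` is `setLanguage[[C]]`. -/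
def setLanguage : FirstOrder.Language.{0, 0} := ⟨fun _ => Empty, MemSymbol⟩

/-- The symbol `∈`, also in the language with constants. -/
def memSymbol (C : Type u) : setLanguage[[C]].Relations 2 :=
  Sum.inl (MemSymbol.mem : setLanguage.Relations 2)

instance {E : Type u} : setLanguage.Structure (Superstructure E) where
  funMap f := nomatch f
  RelMap r := match r with
    | MemSymbol.mem => fun x => Superstructure.Mem (x 0) (x 1)

/-- The atomic formula `t₁ ∈ t₂`. -/
def memFormula {C : Type u} {α : Type v} {n : ℕ} (t₁ t₂ : setLanguage[[C]].Term (α ⊕ Fin n)) :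
    setLanguage[[C]].BoundedFormula α n :=
  (memSymbol C).boundedFormula₂ t₁ t₂

/-- `quantMem t` is the formula `x ∈ t`, where `x` is the variable about to be quantified; `t`
does not contain `x`. -/
def quantMem {C : Type u} {α : Type v} {n : ℕ} (t : setLanguage[[C]].Term (α ⊕ Fin n)) :
    setLanguage[[C]].BoundedFormula α (n + 1) :=
  memFormula (FirstOrder.Language.Term.var (Sum.inr (Fin.last n))) (t.relabel (Sum.map id Fin.castSucc))

/-- The formulas all of whose quantifiers are bounded, i.e. occur in the form
`(∀ x ∈ t) φ`, which is `∀ x (x ∈ t → φ)`, or `(∃ x ∈ t) φ`, which is `∃ x (x ∈ t ∧ φ)`, with `t`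
a constant symbol or a variable other than `x`.  (Not to be confused with Mathlib's type
`BoundedFormula` of all formulas with some of the variables indexed by `Fin n`.) -/
inductive HasBoundedQuantifiers {C : Type u} {α : Type v} :
    {n : ℕ} → setLanguage[[C]].BoundedFormula α n → Prop
  | falsum {n : ℕ} :
      HasBoundedQuantifiers (FirstOrder.Language.BoundedFormula.falsum :
        setLanguage[[C]].BoundedFormula α n)
  | atomic {n : ℕ} {φ : setLanguage[[C]].BoundedFormula α n} :
      φ.IsAtomic → HasBoundedQuantifiers φ
  | imp {n : ℕ} {φ ψ : setLanguage[[C]].BoundedFormula α n} :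
      HasBoundedQuantifiers φ → HasBoundedQuantifiers ψ → HasBoundedQuantifiers (φ.imp ψ)
  | all {n : ℕ} (t : setLanguage[[C]].Term (α ⊕ Fin n))
      {φ : setLanguage[[C]].BoundedFormula α (n + 1)} :
      HasBoundedQuantifiers φ → HasBoundedQuantifiers (((quantMem t).imp φ).all)
  | ex {n : ℕ} (t : setLanguage[[C]].Term (α ⊕ Fin n))
      {φ : setLanguage[[C]].BoundedFormula α (n + 1)} :
      HasBoundedQuantifiers φ → HasBoundedQuantifiers ((quantMem t ⊓ φ).ex)

/-! ### Superstructure embeddings and nonstandard universes -/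

/-- A map `star : V_∞(R) → V_∞(S)` is a superstructure embedding.  The map `i : R → S` is the
inclusion of `R` in `S`. -/
structure IsSuperstructureEmbedding {R : Type u} {S : Type v} (i : R → S)
    (star : Superstructure R → Superstructure S) : Prop where
  injective : Function.Injective star
  base_subset : Function.Injective i
  base_ne : ¬ Function.Surjective i
  star_atom : ∀ r : R, star (Superstructure.atom r) = Superstructure.atom (i r)
  star_base : star (Superstructure.base R) = Superstructure.base S
  mem_iff : ∀ x y : Superstructure R,
    Superstructure.Mem x y ↔ Superstructure.Mem (star x) (star y)

/-- Leibniz' Principle: a sentence `p` with bounded quantifiers and constants from `V_∞(R)` is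
true in `V_∞(R)` if and only if `p*`, obtained by changing each constant `c` to `star c`, is true
in `V_∞(S)`. -/
def LeibnizPrinciple {R : Type u} {S : Type v} (star : Superstructure R → Superstructure S) : Prop :=
  ∀ p : setLanguage[[Superstructure R]].Sentence, HasBoundedQuantifiers p →
    (Superstructure R ⊨ p ↔
      Superstructure S ⊨ (setLanguage.lhomWithConstantsMap star).onSentence p)

/-- A nonstandard universe: a superstructure embedding that satisfies Leibniz' Principle. -/
structure IsNonstandardUniverse {R : Type u} {S : Type v} (i : R → S)
    (star : Superstructure R → Superstructure S) : Prop where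
  embedding : IsSuperstructureEmbedding i star
  leibniz : LeibnizPrinciple star

/-! ### The canonical completion of the reals and the field of `Λ`-limits -/

variable {L : Type u}

/-- The ultrafilter is free: not the principal ultrafilter of a point. -/
def IsFree (U : Ultrafilter L) : Prop := ∀ l : L, U ≠ pure l

/-- Some countable family of members of the ultrafilter has empty intersection. -/
def IsCountablyIncomplete (U : Ultrafilter L) : Prop :=
  ∃ A : ℕ → Set L, (∀ n, A n ∈ U) ∧ ⋂ n, A n = ∅

/-- The underlying set `(L × ℝ) ⊎ ℝ^L/U` of the canonical completion of `ℝ`. -/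
def Completion (U : Ultrafilter L) : Type u := (L × ℝ) ⊕ (U : Filter L).Germ ℝ

namespace Completion

variable (U : Ultrafilter L)

/-- The point `(l, r)` of the canonical completion. -/
def pt (l : L) (r : ℝ) : Completion U := Sum.inl (l, r)

/-- The point `[φ]` of the canonical completion. -/
def cls (φ : L → ℝ) : Completion U := Sum.inr (φ : (U : Filter L).Germ ℝ)

/-- The basic neighbourhood `N_{φ,Q} = {(l, φ l) | l ∈ Q} ∪ {[φ]}`. -/
def nbhd (φ : L → ℝ) (Q : Set L) : Set (Completion U) :=
  ((fun l => pt U l (φ l)) '' Q) ∪ {cls U φ}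

/-- The slim topology: generated by the sets `N_{φ,Q}`, `Q ∈ U`, and all subsets of `L × ℝ`. -/
instance : TopologicalSpace (Completion U) :=
  TopologicalSpace.generateFrom
    ({s | ∃ (φ : L → ℝ) (Q : Set L), Q ∈ U ∧ s = nbhd U φ Q} ∪
      {s | s ⊆ Set.range fun p : L × ℝ => pt U p.1 p.2})

instance : Nonempty (Completion U) := ⟨cls U 0⟩

theorem tendsto_pt (φ : L → ℝ) : Tendsto (fun l => pt U l (φ l)) U (𝓝 (cls U φ)) := by
  rw [TopologicalSpace.tendsto_nhds_generateFrom_iff]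
  rintro s (⟨ψ, Q, hQ, rfl⟩ | hs) hmem
  · rcases hmem with ⟨l, -, h⟩ | h
    · exact absurd h Sum.inl_ne_inr
    · have h' : (U : Filter L).Eventually (fun l => φ l = ψ l) :=
        Filter.Germ.coe_eq.1 (Sum.inr_injective h)
      filter_upwards [h', hQ] with l hl hlQ
      exact Or.inl ⟨l, hlQ, congrArg (pt U l) hl.symm⟩
  · obtain ⟨p, h⟩ := hs hmem
    exact absurd h Sum.inl_ne_inr

/-- For a free ultrafilter the completion is Hausdorff, so that limits are unique. -/
theorem t2Space (hU : IsFree U) : T2Space (Completion U) := by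
  have hco : ∀ l : L, {l}ᶜ ∈ U := fun l => by
    rw [Ultrafilter.compl_mem_iff_notMem]
    intro h
    exact hU l (Ultrafilter.eq_pure_of_finite_mem (Set.finite_singleton l) h |>.elim
      fun x hx => by rw [hx.2, Set.mem_singleton_iff.1 hx.1])
  have hpt : ∀ p : L × ℝ, IsOpen ({pt U p.1 p.2} : Set (Completion U)) := fun p =>
    TopologicalSpace.isOpen_generateFrom_of_mem
      (Or.inr (Set.singleton_subset_iff.2 ⟨p, rfl⟩))
  have hN : ∀ (φ : L → ℝ) (Q : Set L), Q ∈ U → IsOpen (nbhd U φ Q) := fun φ Q hQ =>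
    TopologicalSpace.isOpen_generateFrom_of_mem (Or.inl ⟨φ, Q, hQ, rfl⟩)
  have hmix : ∀ (p : L × ℝ) (φ : L → ℝ),
      Disjoint ({pt U p.1 p.2} : Set (Completion U)) (nbhd U φ {p.1}ᶜ) := by
    intro p φ
    rw [Set.disjoint_singleton_left]
    rintro (⟨l, hl, h⟩ | h)
    · exact hl (congrArg Prod.fst (Sum.inl_injective h))
    · exact absurd h Sum.inl_ne_inr
  refine ⟨?_⟩
  rintro (p | a) (q | b) hne
  · refine ⟨_, _, hpt p, hpt q, rfl, rfl, Set.disjoint_singleton.2 hne⟩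
  · induction b using Filter.Germ.inductionOn with | _ φ =>
    exact ⟨_, _, hpt p, hN φ _ (hco p.1), rfl, Or.inr rfl, hmix p φ⟩
  · induction a using Filter.Germ.inductionOn with | _ φ =>
    exact ⟨_, _, hN φ _ (hco q.1), hpt q, Or.inr rfl, rfl, (hmix q φ).symm⟩
  · induction a using Filter.Germ.inductionOn with | _ φ =>
    induction b using Filter.Germ.inductionOn with | _ ψ =>
    have h : {l | φ l ≠ ψ l} ∈ U := by
      have h' : ¬ ∀ᶠ l in (U : Filter L), φ l = ψ l := fun h =>
        hne (congrArg Sum.inr (Filter.Germ.coe_eq.2 h))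
      exact Ultrafilter.eventually_not.2 h'
    refine ⟨_, _, hN φ _ h, hN ψ _ h, Or.inr rfl, Or.inr rfl, ?_⟩
    rw [Set.disjoint_left]
    rintro _ (⟨l, hl, rfl⟩ | rfl) (⟨m, hm, e⟩ | e)
    · obtain ⟨rfl, e'⟩ := Prod.mk.inj (Sum.inl_injective e)
      exact hl e'.symm
    · exact absurd e Sum.inl_ne_inr
    · exact absurd e Sum.inl_ne_inr
    · exact hne e

end Completion

/-- The set `𝕂` of all limits `lim_{λ → Λ} (λ, φ λ)`, `φ : L → ℝ`, in the canonical completion. -/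
def HyperK (U : Ultrafilter L) : Type u :=
  {ξ : Completion U //
    ∃ φ : L → ℝ, Tendsto (fun l => Completion.pt U l (φ l)) U (𝓝 ξ)}

variable (U : Ultrafilter L)

/-- The limit `lim_{λ → Λ} (λ, φ λ)` of a function `φ : L → ℝ`, as an element of `𝕂`. -/
def realLim (φ : L → ℝ) : HyperK U :=
  ⟨limUnder (U : Filter L) (fun l => Completion.pt U l (φ l)), φ,
    tendsto_nhds_limUnder ⟨_, Completion.tendsto_pt U φ⟩⟩

/-- The inclusion `ℝ ⊆ 𝕂`: a real number is identified with the class of a constant function. -/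
def ofReal (c : ℝ) : HyperK U :=
  ⟨Completion.cls U fun _ => c, fun _ => c, Completion.tendsto_pt U _⟩

/-! ### The `Λ`-limit in the superstructure -/

/-- A point of `V_n(ℝ)` is an atom, i.e. a real number. -/
def Stage.IsReal : (n : ℕ) → Stage ℝ n → Prop
  | 0, _ => True
  | _ + 1, x => ∃ r : ℝ, x = Stage.ofAtom r

/-- The real number given by an atom (`0` for a set; this value is never relevant). -/
def Stage.toReal : (n : ℕ) → Stage ℝ n → ℝ
  | 0, r => r
  | _ + 1, Sum.inl r => r
  | _ + 1, Sum.inr _ => 0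

open Classical in
/-- The limit `lim_{λ → Λ} (λ, φ λ) ∈ V_n(𝕂)` of a function `φ : L → V_n(ℝ)`, by recursion on `n`.
If `φ` is eventually real-valued (in particular if `n = 0`), it is the limit in the canonical
completion of `ℝ`.  Otherwise `φ` is eventually set-valued, and it is the set of the limits of all
`ψ : L → V_{n-1}(ℝ)` with `ψ λ ∈ φ λ` eventually. -/
def lamLim : (n : ℕ) → (L → Stage ℝ n) → Stage (HyperK U) n
  | 0, φ => realLim U φ
  | n + 1, φ =>
    if ∀ᶠ l in (U : Filter L), Stage.IsReal (n + 1) (φ l) then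
      Stage.ofAtom (realLim U fun l => Stage.toReal (n + 1) (φ l))
    else
      Stage.ofSet {ξ | ∃ ψ : L → Stage ℝ n,
        (∀ᶠ l in (U : Filter L), ∃ s : Set (Stage ℝ n), φ l = Stage.ofSet s ∧ ψ l ∈ s) ∧
        ξ = lamLim n ψ}

/-! The `Λ`-limit depends neither on the values of `φ` outside a qualified set nor on the level
`V_n(ℝ)` in which `φ` is considered to take its values. -/

variable {U} in
theorem realLim_congr {φ ψ : L → ℝ} (h : ∀ᶠ l in (U : Filter L), φ l = ψ l) :
    realLim U φ = realLim U ψ := by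
  apply Subtype.ext
  change lim (map _ _) = lim (map _ _)
  rw [Filter.map_congr]
  filter_upwards [h] with l hl
  rw [hl]

variable {U} in
theorem lamLim_pos (n : ℕ) {φ : L → Stage ℝ (n + 1)}
    (h : ∀ᶠ l in (U : Filter L), Stage.IsReal (n + 1) (φ l)) :
    lamLim U (n + 1) φ = Stage.ofAtom (realLim U fun l => Stage.toReal (n + 1) (φ l)) :=
  if_pos h

variable {U} in
theorem lamLim_neg (n : ℕ) {φ : L → Stage ℝ (n + 1)}
    (h : ¬ ∀ᶠ l in (U : Filter L), Stage.IsReal (n + 1) (φ l)) :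
    lamLim U (n + 1) φ = Stage.ofSet {ξ | ∃ ψ : L → Stage ℝ n,
      (∀ᶠ l in (U : Filter L), ∃ s : Set (Stage ℝ n), φ l = Stage.ofSet s ∧ ψ l ∈ s) ∧
      ξ = lamLim U n ψ} :=
  if_neg h

variable {U} in
theorem lamLim_congr (n : ℕ) {φ ψ : L → Stage ℝ n}
    (h : ∀ᶠ l in (U : Filter L), φ l = ψ l) : lamLim U n φ = lamLim U n ψ := by
  cases n with
  | zero => exact realLim_congr h
  | succ n =>
    have h1 : (∀ᶠ l in (U : Filter L), Stage.IsReal (n + 1) (φ l)) ↔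
        ∀ᶠ l in (U : Filter L), Stage.IsReal (n + 1) (ψ l) :=
      Filter.eventually_congr (h.mono fun l hl => by rw [hl])
    by_cases hr : ∀ᶠ l in (U : Filter L), Stage.IsReal (n + 1) (φ l)
    · rw [lamLim_pos n hr, lamLim_pos n (h1.1 hr)]
      exact congrArg Stage.ofAtom (realLim_congr (h.mono fun l hl => by rw [hl]))
    · rw [lamLim_neg n hr, lamLim_neg n (fun h' => hr (h1.2 h'))]
      refine congrArg Stage.ofSet (Set.ext fun ξ => exists_congr fun χ => and_congr_left' ?_)
      exact Filter.eventually_congr (h.mono fun l hl => by rw [hl])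

theorem Stage.isReal_up (n : ℕ) (x : Stage ℝ (n + 1)) :
    Stage.IsReal (n + 2) (Stage.up (n + 1) x) ↔ Stage.IsReal (n + 1) x := by
  rcases x with r | s
  · exact ⟨fun _ => ⟨r, rfl⟩, fun _ => ⟨r, rfl⟩⟩
  · exact ⟨fun ⟨_, h⟩ => absurd h Sum.inr_ne_inl, fun ⟨_, h⟩ => absurd h Sum.inr_ne_inl⟩

theorem Stage.toReal_up (n : ℕ) (x : Stage ℝ n) :
    Stage.toReal (n + 1) (Stage.up n x) = Stage.toReal n x := by
  cases n with
  | zero => rfl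
  | succ n => rcases x with r | s <;> rfl

theorem Stage.exists_of_mem_up {n : ℕ} {x : Stage ℝ (n + 1)} {y : Stage ℝ (n + 1)}
    (h : ∃ t : Set (Stage ℝ (n + 1)), Stage.up (n + 1) x = Stage.ofSet t ∧ y ∈ t) :
    ∃ a : Stage ℝ n, (∃ s : Set (Stage ℝ n), x = Stage.ofSet s ∧ a ∈ s) ∧ y = Stage.up n a := by
  obtain ⟨t, ht, hy⟩ := h
  rcases x with r | s
  · exact absurd ht Sum.inl_ne_inr
  · obtain rfl : Stage.up n '' s = t := Sum.inr_injective ht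
    obtain ⟨a, ha, rfl⟩ := hy
    exact ⟨a, ⟨s, rfl, ha⟩, rfl⟩

theorem lamLim_up : ∀ (n : ℕ) (φ : L → Stage ℝ n),
    lamLim U (n + 1) (fun l => Stage.up n (φ l)) = Stage.up n (lamLim U n φ)
  | 0, φ => lamLim_pos 0 (Filter.Eventually.of_forall fun l => ⟨φ l, rfl⟩)
  | n + 1, φ => by
    have hiff : (∀ᶠ l in (U : Filter L), Stage.IsReal (n + 2) (Stage.up (n + 1) (φ l))) ↔
        ∀ᶠ l in (U : Filter L), Stage.IsReal (n + 1) (φ l) := by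
      simp only [Stage.isReal_up]
    by_cases h : ∀ᶠ l in (U : Filter L), Stage.IsReal (n + 1) (φ l)
    · rw [lamLim_pos n h, lamLim_pos (n + 1) (hiff.2 h)]
      simp only [Stage.toReal_up]
      rfl
    · rw [lamLim_neg n h, lamLim_neg (n + 1) (fun h' => h (hiff.1 h'))]
      refine congrArg Stage.ofSet (Set.ext fun ξ => ⟨?_, ?_⟩)
      · rintro ⟨ψ, hψ, rfl⟩
        obtain ⟨χ, hχ⟩ := (hψ.mono fun l => Stage.exists_of_mem_up).choice
        refine ⟨lamLim U n χ, ⟨χ, hχ.mono fun l hl => hl.1, rfl⟩, ?_⟩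
        rw [← lamLim_up n χ]
        exact lamLim_congr (n + 1) (hχ.mono fun l hl => hl.2.symm)
      · rintro ⟨_, ⟨χ, hχ, rfl⟩, rfl⟩
        refine ⟨fun l => Stage.up n (χ l), hχ.mono ?_, (lamLim_up n χ).symm⟩
        rintro l ⟨s, hs, hl⟩
        exact ⟨Stage.up n '' s, by rw [hs]; rfl, _, hl, rfl⟩

theorem lamLim_incl (m n : ℕ) (h : m ≤ n) (φ : L → Stage ℝ m) :
    lamLim U n (fun l => Stage.incl m n h (φ l)) = Stage.incl m n h (lamLim U m φ) := by
  induction n, h using Nat.le_induction with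
  | base =>
    have e : ∀ {E : Type u} (x : Stage E m), Stage.incl m m le_rfl x = x :=
      fun x => Nat.leRecOn_self x
    have e' : ∀ x : Stage ℝ m, Stage.incl m m le_rfl x = x := fun x => Nat.leRecOn_self x
    rw [e]
    exact lamLim_congr m (Filter.Eventually.of_forall fun l => e' _)
  | succ n h ih =>
    have e : ∀ {E : Type u} (x : Stage E m),
        Stage.incl m (n + 1) (h.trans n.le_succ) x = Stage.up n (Stage.incl m n h x) :=
      fun x => Nat.leRecOn_succ h x
    have e' : ∀ x : Stage ℝ m,
        Stage.incl m (n + 1) (h.trans n.le_succ) x = Stage.up n (Stage.incl m n h x) :=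
      fun x => Nat.leRecOn_succ h x
    rw [e, ← ih, ← lamLim_up]
    exact lamLim_congr (n + 1) (Filter.Eventually.of_forall fun l => e' _)

/-- The map `x ↦ x* = lim_{λ → Λ} (λ, x)` from `V_∞(ℝ)` to `V_∞(𝕂)`. -/
def star : Superstructure ℝ → Superstructure (HyperK U) :=
  DirectLimit.lift (Stage.incl (E := ℝ))
    (fun n x => Superstructure.mk n (lamLim U n fun _ => x))
    (fun m n h x => by
      rw [lamLim_incl]
      exact (DirectLimit.mk_apply (f := Stage.incl (E := HyperK U)) m n _ h).symm)

/-! ### The ultrapower -/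

/-- The ultrapower of `V_∞(ℝ)` modulo `U`. -/
def Ultrapower : Type u := (U : Filter L).Product fun _ => Superstructure ℝ

/-- The class `[F]` in the ultrapower of a function `F : L → V_∞(ℝ)`. -/
def Ultrapower.cls (F : L → Superstructure ℝ) : Ultrapower U :=
  (F : (U : Filter L).Product fun _ => Superstructure ℝ)

/-- Equality and membership of classes hold in the ultrapower if they hold eventually, and a
constant symbol `c` denotes the class of the constant function `c`. -/
instance : setLanguage[[Superstructure ℝ]].Structure (Ultrapower U) :=
  FirstOrder.Language.Ultraproduct.structure (M := fun _ : L => Superstructure ℝ) (u := U)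

end

end LambdaTheory

/-!
Both parts of the theorem rest on a version of Łoś's theorem for the `Λ`-limit (`IsLim.realize_iff`):
if `ξᵢ` is the limit of `Fᵢ : L → V_∞(ℝ)`, then a formula with bounded quantifiers, its constants
starred, holds of the `ξᵢ` exactly when it holds of the `Fᵢ l` for eventually all `l`.

The atomic cases say that limits agree exactly when the functions agree eventually
(`IsLim.eq_iff`, by induction on the level from the Hausdorff property of the completion), and that
membership of limits is eventual membership (`IsLim.mem_iff`).  The quantifier cases use that the
elements of the limit of `G` are precisely the limits of those `F` with `F l ∈ G l` eventually
(`IsLim.exists_of_mem` and `IsLim.exists_of_eventually_mem`).  This is where boundedness is needed: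
`V_∞(𝕂)` also contains sets that are not limits, but the elements of limits are limits again.

Since `x*` is the limit of a constant function, Leibniz' Principle is the case of a sentence, and the
embedding properties are instances of the atomic cases.  Only `ℝ ≠ 𝕂` needs countable
incompleteness, which provides a function `L → ℝ` that is not eventually constant.  The equivalence
with truth in the ultrapower is the classical theorem of Łoś.
-/

open FirstOrder.Language

namespace LambdaTheory

/-! ### Membership in a superstructure -/

theorem Stage.exists_ofSet_eq_and_mem {E : Type*} {n : ℕ} {s : Set (Stage E n)} {a : Stage E n} :
    (∃ t, Stage.ofSet s = Stage.ofSet t ∧ a ∈ t) ↔ a ∈ s :=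
  ⟨fun ⟨_, h, ha⟩ => Sum.inr_injective h ▸ ha, fun ha => ⟨s, rfl, ha⟩⟩

namespace Superstructure

variable {E : Type*}

theorem mk_incl {m n : ℕ} (h : m ≤ n) (x : Stage E m) : mk n (Stage.incl m n h x) = mk m x :=
  DirectLimit.mk_apply (f := Stage.incl (E := E)) m n x h

theorem mk_injective (n : ℕ) : Function.Injective (mk (E := E) n) :=
  DirectLimit.mk_injective (Stage.incl (E := E)) (fun i j h => (Stage.incl i j h).injective) n

theorem exists_eq_mk (x : Superstructure E) : ∃ n a, x = mk n a :=
  DirectLimit.exists_eq_mk (Stage.incl (E := E)) x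

theorem mk_up (n : ℕ) (x : Stage E n) : mk (n + 1) (Stage.up n x) = mk n x := by
  rw [← mk_incl n.le_succ x]
  exact congrArg (mk (n + 1)) (Nat.leRecOn_succ' (C := Stage E) (next := @Stage.up E) x).symm

theorem mk_ofAtom (e : E) : ∀ n : ℕ, mk (n + 1) (Stage.ofAtom e) = atom e
  | 0 => mk_up 0 e
  | n + 1 => (mk_up (n + 1) (Stage.ofAtom e)).trans (mk_ofAtom e n)

theorem mk_ofSet_incl {m n : ℕ} (h : m ≤ n) (s : Set (Stage E m)) :
    mk (n + 1) (Stage.ofSet (Stage.incl m n h '' s)) = mk (m + 1) (Stage.ofSet s) := by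
  induction n, h using Nat.le_induction with
  | base =>
    have e : ∀ x : Stage E m, Stage.incl m m le_rfl x = x := fun x => Nat.leRecOn_self x
    simp only [e, Set.image_id']
  | succ n h ih =>
    have e : ∀ x : Stage E m,
        Stage.incl m (n + 1) (h.trans n.le_succ) x = Stage.up n (Stage.incl m n h x) :=
      fun x => Nat.leRecOn_succ h x
    rw [← ih, ← mk_up (n + 1)]
    refine congrArg (fun t => mk (n + 2) (Stage.ofSet t)) ?_
    rw [Set.image_image]
    exact Set.image_congr fun x _ => e x

theorem mem_mk_ofSet {n : ℕ} {s : Set (Stage E n)} {x : Superstructure E} :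
    Mem x (mk (n + 1) (Stage.ofSet s)) ↔ ∃ a ∈ s, x = mk n a := by
  refine ⟨?_, fun ⟨a, ha, h⟩ => ⟨n, a, s, ha, h, rfl⟩⟩
  rintro ⟨m, b, t, hb, rfl, h⟩
  rw [← mk_ofSet_incl (le_max_left n m), ← mk_ofSet_incl (le_max_right n m)] at h
  have hst := Sum.inr_injective (mk_injective _ h)
  obtain ⟨a, ha, hab⟩ := hst.symm ▸ Set.mem_image_of_mem (Stage.incl m _ (le_max_right n m)) hb
  exact ⟨a, ha, by rw [← mk_incl (le_max_right n m), ← hab, mk_incl]⟩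

theorem not_mem_atom (x : Superstructure E) (e : E) : ¬ Mem x (atom e) := by
  rintro ⟨n, a, s, -, -, h⟩
  rw [← mk_ofAtom e n] at h
  exact Sum.inl_ne_inr (mk_injective _ h)

theorem mem_mk_succ {n : ℕ} {x : Superstructure E} {y : Stage E (n + 1)} :
    Mem x (mk (n + 1) y) ↔ ∃ a, (∃ s, y = Stage.ofSet s ∧ a ∈ s) ∧ x = mk n a := by
  rcases y with e | s
  · refine ⟨fun h => absurd ((mk_ofAtom e n) ▸ h) (not_mem_atom x e), ?_⟩
    rintro ⟨_, ⟨s, h, -⟩, -⟩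
    exact absurd h Sum.inl_ne_inr
  · exact mem_mk_ofSet.trans
      (exists_congr fun a => and_congr_left' Stage.exists_ofSet_eq_and_mem.symm)

instance : Nonempty (Superstructure E) := ⟨base E⟩

end Superstructure

open Superstructure

/-! ### The limit determines the function up to eventual equality -/

theorem Stage.not_isReal_ofSet {n : ℕ} (s : Set (Stage ℝ n)) :
    ¬ Stage.IsReal (n + 1) (Stage.ofSet s) :=
  fun ⟨_, h⟩ => Sum.inr_ne_inl h

theorem Stage.IsReal.eq_ofAtom {n : ℕ} {x : Stage ℝ (n + 1)} (h : Stage.IsReal (n + 1) x) :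
    x = Stage.ofAtom (Stage.toReal (n + 1) x) := by
  obtain ⟨r, rfl⟩ := h
  rfl

theorem Stage.exists_eq_ofSet {n : ℕ} {x : Stage ℝ (n + 1)} (h : ¬ Stage.IsReal (n + 1) x) :
    ∃ s, x = Stage.ofSet s := by
  rcases x with r | s
  · exact absurd ⟨r, rfl⟩ h
  · exact ⟨s, rfl⟩

variable {L : Type*} {U : Ultrafilter L}

theorem coe_realLim (hU : IsFree U) (φ : L → ℝ) : (realLim U φ).1 = Completion.cls U φ :=
  have := Completion.t2Space U hU
  (Completion.tendsto_pt U φ).limUnder_eq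

theorem realLim_eq_iff (hU : IsFree U) {φ ψ : L → ℝ} :
    realLim U φ = realLim U ψ ↔ ∀ᶠ l in (U : Filter L), φ l = ψ l := by
  refine ⟨fun h => ?_, realLim_congr⟩
  have h' := congrArg Subtype.val h
  rw [coe_realLim hU, coe_realLim hU] at h'
  exact Filter.Germ.coe_eq.1 (Sum.inr_injective h')

theorem realLim_const (hU : IsFree U) (c : ℝ) : (realLim U fun _ => c) = ofReal U c :=
  Subtype.ext (coe_realLim hU _)

theorem realLim_surjective (hU : IsFree U) (ξ : HyperK U) : ∃ φ, realLim U φ = ξ := by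
  obtain ⟨ξ, φ, h⟩ := ξ
  have := Completion.t2Space U hU
  exact ⟨φ, Subtype.ext h.limUnder_eq⟩

/-- The nontrivial half of extensionality for set-valued limits: where `ψ` is eventually a set not
contained in the value of `φ`, some limit belongs to the limit of `ψ` but not to that of `φ`. -/
theorem exists_not_mem_of_eventually {n : ℕ} {φ ψ : L → Stage ℝ (n + 1)}
    (ih : ∀ χ χ' : L → Stage ℝ n, lamLim U n χ = lamLim U n χ' →
      ∀ᶠ l in (U : Filter L), χ l = χ' l)
    (h : ∀ᶠ l in (U : Filter L), ∃ a, (∃ s, ψ l = Stage.ofSet s ∧ a ∈ s) ∧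
      ¬ ∃ s, φ l = Stage.ofSet s ∧ a ∈ s) :
    ∃ ξ, (∃ χ : L → Stage ℝ n,
        (∀ᶠ l in (U : Filter L), ∃ s, ψ l = Stage.ofSet s ∧ χ l ∈ s) ∧ ξ = lamLim U n χ) ∧
      ¬ ∃ χ : L → Stage ℝ n,
        (∀ᶠ l in (U : Filter L), ∃ s, φ l = Stage.ofSet s ∧ χ l ∈ s) ∧ ξ = lamLim U n χ := by
  obtain ⟨χ, hχ⟩ := h.choice
  refine ⟨_, ⟨χ, hχ.mono fun l hl => hl.1, rfl⟩, ?_⟩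
  rintro ⟨χ', hχ', h'⟩
  obtain ⟨l, hl, hl', he⟩ := (hχ.and (hχ'.and (ih _ _ h'))).exists
  exact hl.2 (he ▸ hl')

theorem eventually_eq_of_lamLim_eq (hU : IsFree U) : ∀ (n : ℕ) (φ ψ : L → Stage ℝ n),
    lamLim U n φ = lamLim U n ψ → ∀ᶠ l in (U : Filter L), φ l = ψ l
  | 0, _, _, h => (realLim_eq_iff hU).1 h
  | n + 1, φ, ψ, h => by
    by_cases hφ : ∀ᶠ l in (U : Filter L), Stage.IsReal (n + 1) (φ l) <;>
    by_cases hψ : ∀ᶠ l in (U : Filter L), Stage.IsReal (n + 1) (ψ l)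
    · rw [lamLim_pos n hφ, lamLim_pos n hψ] at h
      filter_upwards [hφ, hψ, (realLim_eq_iff hU).1 (Sum.inl_injective h)] with l h1 h2 h3
      rw [h1.eq_ofAtom, h2.eq_ofAtom, h3]
    · rw [lamLim_pos n hφ, lamLim_neg n hψ] at h
      exact absurd h Sum.inl_ne_inr
    · rw [lamLim_neg n hφ, lamLim_pos n hψ] at h
      exact absurd h Sum.inr_ne_inl
    · rw [lamLim_neg n hφ, lamLim_neg n hψ] at h
      have h := Set.ext_iff.1 (Sum.inr_injective h)
      by_contra hne
      have ih := eventually_eq_of_lamLim_eq hU n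
      -- Eventually one of the two sets has an element that is not in the other; since `U` is an
      -- ultrafilter, it is eventually the same one.
      have hdiff : ∀ᶠ l in (U : Filter L),
          (∃ a, (∃ s, ψ l = Stage.ofSet s ∧ a ∈ s) ∧ ¬ ∃ s, φ l = Stage.ofSet s ∧ a ∈ s) ∨
          (∃ a, (∃ s, φ l = Stage.ofSet s ∧ a ∈ s) ∧ ¬ ∃ s, ψ l = Stage.ofSet s ∧ a ∈ s) := by
        filter_upwards [Ultrafilter.eventually_not.2 hφ, Ultrafilter.eventually_not.2 hψ,
          Ultrafilter.eventually_not.2 hne] with l h1 h2 h3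
        obtain ⟨s, hs⟩ := Stage.exists_eq_ofSet h1
        obtain ⟨t, ht⟩ := Stage.exists_eq_ofSet h2
        simp only [hs, ht, Stage.exists_ofSet_eq_and_mem]
        by_contra! hcon
        exact h3 (by rw [hs, ht, Set.Subset.antisymm hcon.2 hcon.1])
      rcases Ultrafilter.eventually_or.1 hdiff with hd | hd
      · obtain ⟨ξ, h1, h2⟩ := exists_not_mem_of_eventually ih hd
        exact h2 ((h ξ).2 h1)
      · obtain ⟨ξ, h1, h2⟩ := exists_not_mem_of_eventually ih hd
        exact h2 ((h ξ).1 h1)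

/-! ### Limits of functions with values in the superstructure -/

/-- `ξ ∈ V_∞(𝕂)` is the `Λ`-limit of `F : L → V_∞(ℝ)`: for some `n`, the values of `F` are
eventually those of a function with values in `V_n(ℝ)`, and `ξ` is its limit. -/
def IsLim (U : Ultrafilter L) (F : L → Superstructure ℝ) (ξ : Superstructure (HyperK U)) : Prop :=
  ∃ (n : ℕ) (φ : L → Stage ℝ n),
    (∀ᶠ l in (U : Filter L), F l = mk n (φ l)) ∧ ξ = mk n (lamLim U n φ)

theorem isLim_mk (n : ℕ) (φ : L → Stage ℝ n) :
    IsLim U (fun l => mk n (φ l)) (mk n (lamLim U n φ)) :=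
  ⟨n, φ, Filter.Eventually.of_forall fun _ => rfl, rfl⟩

theorem isLim_star (x : Superstructure ℝ) : IsLim U (fun _ => x) (star U x) := by
  obtain ⟨n, a, rfl⟩ := exists_eq_mk x
  exact isLim_mk n fun _ => a

namespace IsLim

variable {F G : L → Superstructure ℝ} {ξ η : Superstructure (HyperK U)}

/-- The level witnessing a limit can be chosen to be any sufficiently large one. -/
theorem exists_forall_ge (h : IsLim U F ξ) : ∃ m, ∀ n, m ≤ n → ∃ φ : L → Stage ℝ n,
    (∀ᶠ l in (U : Filter L), F l = mk n (φ l)) ∧ ξ = mk n (lamLim U n φ) := by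
  obtain ⟨m, φ, hF, rfl⟩ := h
  refine ⟨m, fun n hmn => ⟨fun l => Stage.incl m n hmn (φ l), ?_, ?_⟩⟩
  · exact hF.mono fun l hl => by rw [hl, mk_incl]
  · rw [lamLim_incl, mk_incl]

theorem eq_iff (hU : IsFree U) (hF : IsLim U F ξ) (hG : IsLim U G η) :
    ξ = η ↔ ∀ᶠ l in (U : Filter L), F l = G l := by
  obtain ⟨m, hm⟩ := hF.exists_forall_ge
  obtain ⟨n, hn⟩ := hG.exists_forall_ge
  obtain ⟨φ, hφ, rfl⟩ := hm _ (le_max_left m n)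
  obtain ⟨ψ, hψ, rfl⟩ := hn _ (le_max_right m n)
  rw [(mk_injective _).eq_iff]
  constructor
  · intro h
    filter_upwards [hφ, hψ, eventually_eq_of_lamLim_eq hU _ _ _ h] with l h1 h2 h3
    rw [h1, h2, h3]
  · intro h
    refine lamLim_congr _ ?_
    filter_upwards [hφ, hψ, h] with l h1 h2 h3
    exact mk_injective _ (by rw [← h1, ← h2, h3])

/-- The elements of a limit are limits. -/
theorem exists_of_mem (hG : IsLim U G η) (h : Mem ξ η) :
    ∃ F, IsLim U F ξ ∧ ∀ᶠ l in (U : Filter L), Mem (F l) (G l) := by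
  obtain ⟨n, hn⟩ := hG.exists_forall_ge
  obtain ⟨ψ, hψ, rfl⟩ := hn _ n.le_succ
  by_cases hr : ∀ᶠ l in (U : Filter L), Stage.IsReal (n + 1) (ψ l)
  · rw [lamLim_pos n hr, mk_ofAtom] at h
    exact absurd h (not_mem_atom _ _)
  · rw [lamLim_neg n hr, mem_mk_ofSet] at h
    obtain ⟨_, ⟨χ, hχ, rfl⟩, rfl⟩ := h
    refine ⟨_, isLim_mk n χ, ?_⟩
    filter_upwards [hψ, hχ] with l h1 h2
    rw [h1, mem_mk_succ]
    exact ⟨_, h2, rfl⟩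

theorem exists_of_eventually_mem (hG : IsLim U G η)
    (h : ∀ᶠ l in (U : Filter L), Mem (F l) (G l)) : ∃ ξ, IsLim U F ξ ∧ Mem ξ η := by
  obtain ⟨n, hn⟩ := hG.exists_forall_ge
  obtain ⟨ψ, hψ, rfl⟩ := hn _ n.le_succ
  have h' : ∀ᶠ l in (U : Filter L), ∃ a, (∃ s, ψ l = Stage.ofSet s ∧ a ∈ s) ∧ F l = mk n a := by
    filter_upwards [h, hψ] with l h1 h2
    rwa [h2, mem_mk_succ] at h1
  obtain ⟨χ, hχ⟩ := h'.choice
  refine ⟨_, ⟨n, χ, hχ.mono fun l hl => hl.2, rfl⟩, ?_⟩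
  have hr : ¬ ∀ᶠ l in (U : Filter L), Stage.IsReal (n + 1) (ψ l) := by
    intro hr
    obtain ⟨l, hl, ⟨s, hs, -⟩, -⟩ := (hr.and hχ).exists
    exact Stage.not_isReal_ofSet s (hs ▸ hl)
  rw [lamLim_neg n hr, mem_mk_ofSet]
  exact ⟨_, ⟨χ, hχ.mono fun l hl => hl.1, rfl⟩, rfl⟩

theorem mem_iff (hU : IsFree U) (hF : IsLim U F ξ) (hG : IsLim U G η) :
    Mem ξ η ↔ ∀ᶠ l in (U : Filter L), Mem (F l) (G l) := by
  constructor
  · intro h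
    obtain ⟨F', hF', h'⟩ := hG.exists_of_mem h
    filter_upwards [h', (hF.eq_iff hU hF').1 rfl] with l h1 h2
    rwa [h2]
  · intro h
    obtain ⟨ξ', hξ', h'⟩ := hG.exists_of_eventually_mem h
    rwa [(hF.eq_iff hU hξ').2 (Filter.Eventually.of_forall fun _ => rfl)]

/-- Bounded existential quantification commutes with passing to the limit. -/
theorem exists_mem_iff (hG : IsLim U G η) {P : Superstructure (HyperK U) → Prop}
    {Q : L → Superstructure ℝ → Prop}
    (hPQ : ∀ F ξ, IsLim U F ξ → (P ξ ↔ ∀ᶠ l in (U : Filter L), Q l (F l))) :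
    (∃ ξ, Mem ξ η ∧ P ξ) ↔ ∀ᶠ l in (U : Filter L), ∃ x, Mem x (G l) ∧ Q l x := by
  constructor
  · rintro ⟨ξ, hm, hP⟩
    obtain ⟨F, hF, h⟩ := hG.exists_of_mem hm
    filter_upwards [h, (hPQ F ξ hF).1 hP] with l h1 h2
    exact ⟨F l, h1, h2⟩
  · intro h
    obtain ⟨F, hF⟩ := h.choice
    obtain ⟨ξ, hξ, hm⟩ := hG.exists_of_eventually_mem (hF.mono fun l hl => hl.1)
    exact ⟨ξ, hm, (hPQ F ξ hξ).2 (hF.mono fun l hl => hl.2)⟩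

theorem forall_mem_iff (hG : IsLim U G η) {P : Superstructure (HyperK U) → Prop}
    {Q : L → Superstructure ℝ → Prop}
    (hPQ : ∀ F ξ, IsLim U F ξ → (P ξ ↔ ∀ᶠ l in (U : Filter L), Q l (F l))) :
    (∀ ξ, Mem ξ η → P ξ) ↔ ∀ᶠ l in (U : Filter L), ∀ x, Mem x (G l) → Q l x := by
  have h := hG.exists_mem_iff (P := fun ξ => ¬ P ξ) (Q := fun l x => ¬ Q l x)
    fun F ξ hF => (not_congr (hPQ F ξ hF)).trans Ultrafilter.eventually_not.symm
  rw [← not_iff_not, ← Ultrafilter.eventually_not]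
  simpa only [not_forall, exists_prop] using h

end IsLim

/-! ### Łoś's theorem for the `Λ`-limit -/

theorem realize_memFormula {E : Type*} {α : Type*} {n : ℕ}
    (t₁ t₂ : setLanguage[[Superstructure E]].Term (α ⊕ Fin n)) (v : α → Superstructure E)
    (xs : Fin n → Superstructure E) :
    (memFormula t₁ t₂).Realize v xs ↔
      Mem (t₁.realize (Sum.elim v xs)) (t₂.realize (Sum.elim v xs)) := by
  rw [memFormula, BoundedFormula.realize_rel₂]
  rfl

theorem realize_quantMem {E : Type*} {α : Type*} {n : ℕ}
    (t : setLanguage[[Superstructure E]].Term (α ⊕ Fin n)) (v : α → Superstructure E)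
    (xs : Fin n → Superstructure E) (x : Superstructure E) :
    (quantMem t).Realize v (Fin.snoc xs x) ↔ Mem x (t.realize (Sum.elim v xs)) := by
  rw [quantMem, realize_memFormula, Term.realize_relabel, Term.realize_var, Sum.elim_inr,
    Fin.snoc_last, Sum.elim_comp_map, Function.comp_id, Fin.snoc_comp_castSucc]

theorem onTerm_relabel {L₁ L₂ : Language} (g : L₁ →ᴸ L₂) {α β : Type*} (f : α → β)
    (t : L₁.Term α) : g.onTerm (t.relabel f) = (g.onTerm t).relabel f := by
  induction t with
  | var => rfl
  | func h ts ih => simp only [LHom.onTerm, Term.relabel, ih]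

theorem onBoundedFormula_quantMem {C D : Type*} (f : C → D) {α : Type*} {n : ℕ}
    (t : setLanguage[[C]].Term (α ⊕ Fin n)) :
    (setLanguage.lhomWithConstantsMap f).onBoundedFormula (quantMem t) =
      quantMem ((setLanguage.lhomWithConstantsMap f).onTerm t) := by
  refine congrArg ((memSymbol D).boundedFormula ·) (funext fun i => ?_)
  fin_cases i
  · rfl
  · exact onTerm_relabel _ _ t

/-- The value of a term, its constants starred, is the limit of its values: a term is a variable or
a constant symbol. -/
theorem isLim_realize_term {α : Type*} (t : setLanguage[[Superstructure ℝ]].Term α)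
    {v : α → L → Superstructure ℝ} {w : α → Superstructure (HyperK U)}
    (hv : ∀ i, IsLim U (v i) (w i)) :
    IsLim U (fun l => t.realize fun i => v i l)
      (((setLanguage.lhomWithConstantsMap (star U)).onTerm t).realize w) := by
  cases t with
  | var i => exact hv i
  | @func n f ts =>
    rcases f with f | f
    · exact nomatch f
    · cases n with
      | zero => exact isLim_star f
      | succ n => exact nomatch f

theorem IsLim.realize_iff (hU : IsFree U) {α : Type*} {n : ℕ}
    {p : setLanguage[[Superstructure ℝ]].BoundedFormula α n} (hp : HasBoundedQuantifiers p)
    {v : α → L → Superstructure ℝ} {w : α → Superstructure (HyperK U)}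
    (hv : ∀ i, IsLim U (v i) (w i))
    {xs : Fin n → L → Superstructure ℝ} {ys : Fin n → Superstructure (HyperK U)}
    (hx : ∀ i, IsLim U (xs i) (ys i)) :
    ((setLanguage.lhomWithConstantsMap (star U)).onBoundedFormula p).Realize w ys ↔
      ∀ᶠ l in (U : Filter L), p.Realize (fun i => v i l) fun i => xs i l := by
  have hterm : ∀ {n : ℕ} (t : setLanguage[[Superstructure ℝ]].Term (α ⊕ Fin n))
      {xs : Fin n → L → Superstructure ℝ} {ys : Fin n → Superstructure (HyperK U)},
      (∀ i, IsLim U (xs i) (ys i)) →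
      IsLim U (fun l => t.realize (Sum.elim (fun i => v i l) fun i => xs i l))
        (((setLanguage.lhomWithConstantsMap (star U)).onTerm t).realize (Sum.elim w ys)) := by
    intro n t xs ys hx
    have h := isLim_realize_term (v := Sum.elim v xs) (w := Sum.elim w ys) t
      (fun i => by cases i; exacts [hv _, hx _])
    convert h using 3 with l
    ext i
    cases i <;> rfl
  have hsnoc : ∀ {n : ℕ} {xs : Fin n → L → Superstructure ℝ}
      {ys : Fin n → Superstructure (HyperK U)}, (∀ i, IsLim U (xs i) (ys i)) →
      ∀ F ξ, IsLim U F ξ → ∀ i : Fin (n + 1),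
        IsLim U (fun l => Fin.snoc (α := fun _ => Superstructure ℝ) (fun j => xs j l) (F l) i)
          (Fin.snoc (α := fun _ => Superstructure (HyperK U)) ys ξ i) := by
    intro n xs ys hx F ξ hF i
    refine Fin.lastCases ?_ (fun j => ?_) i
    · simpa only [Fin.snoc_last] using hF
    · simpa only [Fin.snoc_castSucc] using hx j
  induction hp with
  | falsum => simp only [LHom.onBoundedFormula, BoundedFormula.Realize, eventually_const]
  | atomic h =>
    cases h with
    | equal t₁ t₂ => exact (hterm t₁ hx).eq_iff hU (hterm t₂ hx)
    | @rel k R ts =>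
      rcases R with R | R
      · cases R
        exact (hterm (ts 0) hx).mem_iff hU (hterm (ts 1) hx)
      · exact nomatch R
  | imp _ _ ih₁ ih₂ =>
    simp only [LHom.onBoundedFormula, BoundedFormula.realize_imp, ih₁ hx, ih₂ hx,
      Ultrafilter.eventually_imp]
  | all t _ ih =>
    simp only [LHom.onBoundedFormula, onBoundedFormula_quantMem, BoundedFormula.realize_all,
      BoundedFormula.realize_imp, realize_quantMem]
    exact (hterm t hx).forall_mem_iff fun F ξ hF => ih (hsnoc hx F ξ hF)
  | @ex _ t φ _ ih =>
    have e : (setLanguage.lhomWithConstantsMap (star U)).onBoundedFormula (quantMem t ⊓ φ).ex =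
        (quantMem ((setLanguage.lhomWithConstantsMap (star U)).onTerm t) ⊓
          (setLanguage.lhomWithConstantsMap (star U)).onBoundedFormula φ).ex := by
      rw [← onBoundedFormula_quantMem]
      rfl
    simp only [e, BoundedFormula.realize_ex, BoundedFormula.realize_inf, realize_quantMem]
    exact (hterm t hx).exists_mem_iff fun F ξ hF => ih (hsnoc hx F ξ hF)

theorem IsLim.formula_realize_iff (hU : IsFree U) {α : Type*}
    {p : setLanguage[[Superstructure ℝ]].Formula α} (hp : HasBoundedQuantifiers p)
    {v : α → L → Superstructure ℝ} {w : α → Superstructure (HyperK U)}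
    (hv : ∀ i, IsLim U (v i) (w i)) :
    ((setLanguage.lhomWithConstantsMap (star U)).onFormula p).Realize w ↔
      ∀ᶠ l in (U : Filter L), p.Realize fun i => v i l := by
  have h := IsLim.realize_iff hU hp hv (xs := finZeroElim) (ys := default) finZeroElim
  simp only [Unique.eq_default] at h
  exact h

/-! ### The nonstandard universe -/

/-- Countable incompleteness makes the reals a proper subset of `𝕂`: the function that sends `l` to
the first `n` with `l ∉ A n` is not eventually constant, since it differs from `n` on `A n`. -/
theorem ofReal_not_surjective (hU : IsFree U) (hinc : IsCountablyIncomplete U) :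
    ¬ Function.Surjective (ofReal U) := by
  obtain ⟨A, hA, hempty⟩ := hinc
  have hex : ∀ l, ∃ n, l ∉ A n := by
    intro l
    by_contra! h
    exact Set.notMem_empty l (hempty ▸ Set.mem_iInter.2 h)
  choose f hf using hex
  intro hsurj
  obtain ⟨c, hc⟩ := hsurj (realLim U fun l => (f l : ℝ))
  rw [← realLim_const hU, realLim_eq_iff hU] at hc
  obtain ⟨l₀, hl₀⟩ := hc.exists
  obtain ⟨l, hl, hlA⟩ := (hc.and (hA (f l₀))).exists
  have : f l = f l₀ := by exact_mod_cast hl.symm.trans hl₀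
  exact hf l (this ▸ hlA)

theorem star_base (hU : IsFree U) : star U (base ℝ) = base (HyperK U) := by
  change mk 1 (lamLim U 1 fun _ => Stage.ofSet Set.univ) = _
  rw [lamLim_neg 0 (by
    rw [Filter.eventually_const]; exact Stage.not_isReal_ofSet _)]
  refine congrArg (fun s => mk 1 (Stage.ofSet s)) (Set.eq_univ_of_forall fun ξ => ?_)
  obtain ⟨φ, rfl⟩ := realLim_surjective hU ξ
  exact ⟨φ, Filter.Eventually.of_forall fun _ => ⟨_, rfl, trivial⟩, rfl⟩

theorem isSuperstructureEmbedding_star (hU : IsFree U) (hinc : IsCountablyIncomplete U) :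
    IsSuperstructureEmbedding (ofReal U) (star U) where
  injective x y h := by
    simpa only [Filter.eventually_const] using ((isLim_star x).eq_iff hU (isLim_star y)).1 h
  base_subset a b h := by
    rw [← realLim_const hU, ← realLim_const hU, realLim_eq_iff hU, Filter.eventually_const] at h
    exact h
  base_ne := ofReal_not_surjective hU hinc
  star_atom r := congrArg (mk 0) (realLim_const hU r)
  star_base := star_base hU
  mem_iff x y := by
    rw [(isLim_star x).mem_iff hU (isLim_star y), Filter.eventually_const]

theorem leibnizPrinciple_star (hU : IsFree U) : LeibnizPrinciple (star U) := by
  intro p hp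
  have h := IsLim.formula_realize_iff (U := U) hU hp
    (v := fun i => nomatch i) (w := default) (fun i => nomatch i)
  rw [Sentence.Realize, Sentence.Realize]
  refine Iff.symm (h.trans ?_)
  simp only [Unique.eq_default, Filter.eventually_const]

end LambdaTheory

theorem mainTheorem2 {L : Type*} (U : Ultrafilter L) (hfree : LambdaTheory.IsFree U) :
    (LambdaTheory.IsCountablyIncomplete U →
      LambdaTheory.IsNonstandardUniverse (LambdaTheory.ofReal U) (LambdaTheory.star U)) ∧
    ∀ (k : ℕ) (p : LambdaTheory.setLanguage[[LambdaTheory.Superstructure ℝ]].Formula (Fin k)),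
      LambdaTheory.HasBoundedQuantifiers p →
      ∀ (n : Fin k → ℕ) (φ : ∀ i, L → LambdaTheory.Stage ℝ (n i)),
        (((LambdaTheory.setLanguage.lhomWithConstantsMap (LambdaTheory.star U)).onFormula p).Realize
            (fun i => LambdaTheory.Superstructure.mk (n i) (LambdaTheory.lamLim U (n i) (φ i))) ↔
          {l | p.Realize fun i => LambdaTheory.Superstructure.mk (n i) (φ i l)} ∈ U) ∧
        ({l | p.Realize fun i => LambdaTheory.Superstructure.mk (n i) (φ i l)} ∈ U ↔
          p.Realize fun i => LambdaTheory.Ultrapower.cls U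
            fun l => LambdaTheory.Superstructure.mk (n i) (φ i l)) := by
  refine ⟨fun hinc => ⟨LambdaTheory.isSuperstructureEmbedding_star hfree hinc,
    LambdaTheory.leibnizPrinciple_star hfree⟩, fun k p hp n φ => ⟨?_, ?_⟩⟩
  · exact LambdaTheory.IsLim.formula_realize_iff hfree hp
      fun i => LambdaTheory.isLim_mk (n i) (φ i)
  · exact (Ultraproduct.realize_formula_cast (u := U) p
      fun i l => LambdaTheory.Superstructure.mk (n i) (φ i l)).symm
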